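/- Let $n, h \ge 0$ be integers. A \emph{labeled graph} is an undirected graph $\mathbf G$, with vertex set $V$, whose edges are labeled by $n$ labels $1,\dots,n$ (two vertices may be connected by edges with several different labels), together with $h$ distinguished vertices $d_1,\dots,d_h\in V$. For symmetric and reflexive binary relations $R_1,\dots,R_n$ on a set $A$, let $\mathbf G(R_1,\dots,R_n)\subseteq A^h$ be the set of all tuples $(a_1,\dots,a_h)$ for which there is a function $c:V\to A$ such that $a_k=c(d_k)$ for $k=1,\dots,h$, and such that $c(x)\mathrel{R_i}c(y)$ whenever $x,y\in V$ are connected by an edge labeled $i$. For each label $i$ let $\sim_i$ be the least equivalence relation on $V$ such that $x\sim_i y$ whenever $x,y$ are connected by an edge labeled $i$. The graph $\mathbf G$ is \emph{regular} if it is finite and, for every $i$, every equivalence class of $\sim_i$ has at most $2$ elements. A \emph{tolerance} on an algebra is a compatible, reflexive and symmetric binary relation. A tolerance $\Theta$ is \emph{representable} if $\Theta=R\circ R^-$ for some compatible and reflexive relation $R$, where $R^-$ denotes the converse of $R$. It is \emph{weakly representable} if $\Theta=\bigcap_{k\in K}(R_k\circ R_k^-)$ for some (possibly infinite) family $(R_k)_{k\in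 K}$ of compatible and reflexive relations. \textbf{Theorem.} Let $\mathcal V$ be a variety of algebras, and let $\mathbf G$, $\mathbf H$ be labeled graphs, both with $n$ labels and $h$ distinguished vertices, where $\mathbf G$ is regular and $\mathbf H$ is arbitrary (possibly infinite). Then the following are equivalent. (i) $\mathbf G(\alpha_1,\dots,\alpha_n)\subseteq\mathbf H(\alpha_1,\dots,\alpha_n)$ for every algebra in $\mathcal V$ and all congruences $\alpha_1,\dots,\alpha_n$ on it. (ii) $\mathbf G(\Theta_1,\dots,\Theta_n)\subseteq\mathbf H(\Theta_1,\dots,\Theta_n)$ for every algebra in $\mathcal V$ and all representable tolerances $\Theta_1,\dots,\Theta_n$ on it. (iii) $\mathbf G(\Theta_1,\dots,\Theta_n)\subseteq\mathbf H(\Theta_1,\dots,\Theta_n)$ for every algebra in $\mathcal V$ and all weakly representable tolerances $\Theta_1,\dots,\Theta_n$ on it. (iv) $\mathbf G(\Theta_1\circ\Theta_1,\dots,\Theta_n\circ\Theta_n)\subseteq\mathbf H(\Theta_1\circ\Theta_1,\dots,\Theta_n\circ\Theta_n)$ for every algebra in $\mathcal V$ and all tolerances $\Theta_1,\dots,\Theta_n$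 on it. -/

import Mathlib

universe u v w uV uW

namespace GraphInclusion

/-! Algebras are structures over a first-order language that has only function symbols. -/

section Relations

variable (L : FirstOrder.Language.{u, v}) {A : Type w} [L.Structure A]

/-- A binary relation on an algebra is compatible if it is preserved by all basic operations. -/
def Compatible (R : A → A → Prop) : Prop :=
  ∀ ⦃m : ℕ⦄ (f : L.Functions m) (x y : Fin m → A),
    (∀ j, R (x j) (y j)) →
      R (FirstOrder.Language.Structure.funMap f x)
        (FirstOrder.Language.Structure.funMap f y)

/-- A congruence is a compatible equivalence relation. -/
def IsCongruence (R : A → A → Prop) : Prop :=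
  Equivalence R ∧ Compatible L R

/-- A tolerance is a compatible, reflexive and symmetric relation. -/
def IsTolerance (R : A → A → Prop) : Prop :=
  (∀ a, R a a) ∧ (∀ a b, R a b → R b a) ∧ Compatible L R

/-- A tolerance `Θ` is representable if `Θ = R ∘ R⁻` for some compatible and reflexive `R`. -/
def IsRepresentable (Θ : A → A → Prop) : Prop :=
  IsTolerance L Θ ∧
    ∃ R : A → A → Prop, Compatible L R ∧ (∀ a, R a a) ∧ Θ = Relation.Comp R (flip R)

/-- A tolerance `Θ` is weakly representable if it is the intersection of a family, possibly
infinite, of relations `R k ∘ (R k)⁻` with every `R k` compatible and reflexive. (Up to repetition,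
every family of relations on `A` is indexed by a type in the universe of `A`.) -/
def IsWeaklyRepresentable (Θ : A → A → Prop) : Prop :=
  IsTolerance L Θ ∧
    ∃ (K : Type w) (R : K → A → A → Prop),
      (∀ k, Compatible L (R k) ∧ ∀ a, R k a a) ∧
        ∀ a b, Θ a b ↔ ∀ k, Relation.Comp (R k) (flip (R k)) a b

end Relations

/-- A variety: the class of all (nonempty) algebras that satisfy some given set of identities
between terms in countably many variables. -/
def IsVariety {L : FirstOrder.Language.{u, v}}
    (𝒱 : Set (CategoryTheory.Bundled.{w} L.Structure)) : Prop :=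
  ∃ E : Set (L.Term ℕ × L.Term ℕ),
    ∀ A : CategoryTheory.Bundled.{w} L.Structure,
      A ∈ 𝒱 ↔ Nonempty A ∧ ∀ e ∈ E, ∀ x : ℕ → A, e.1.realize x = e.2.realize x

/-- An (undirected) graph on the vertex set `V` with edges labeled by `n` labels and with `h`
distinguished vertices. Two vertices may be connected by edges with several labels. -/
structure LabeledGraph (V : Type u) (n h : ℕ) where
  /-- `Adj i x y`: the vertices `x` and `y` are connected by an edge with label `i`. -/
  Adj : Fin n → V → V → Prop
  symm : ∀ i x y, Adj i x y → Adj i y x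
  /-- The distinguished vertices. -/
  dist : Fin h → V

namespace LabeledGraph

variable {V : Type u} {n h : ℕ} (G : LabeledGraph V n h)

/-- The least equivalence relation relating vertices that are connected by an edge labeled `i`. -/
def Conn (i : Fin n) : V → V → Prop :=
  Relation.EqvGen (G.Adj i)

/-- A graph is regular if it is finite and, for every label `i`, each equivalence class of
`Conn i` has at most two elements. -/
def Regular : Prop :=
  Finite V ∧ ∀ i x, {y | G.Conn i x y}.encard ≤ 2

/-- The `h`-ary relation `G(R₁, …, Rₙ)` on `A`: the set of all tuples that can be connected by the
graph `G`, with the label `i` interpreted as the relation `R i`. -/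
def rel {A : Type w} (R : Fin n → A → A → Prop) : Set (Fin h → A) :=
  {a | ∃ c : V → A, (∀ k, a k = c (G.dist k)) ∧ ∀ i x y, G.Adj i x y → R i (c x) (c y)}

end LabeledGraph

end GraphInclusion

/-!
Representable tolerances are weakly representable, `Θ ∘ Θ = Θ ∘ Θ⁻` is representable for every
tolerance `Θ`, and a congruence `α` is a tolerance with `α ∘ α = α`. So the one substantial
implication is from congruences to weakly representable tolerances.

It goes through a Mal'cev condition. In the free algebra of `𝒱` on the vertices of `G`, let the
`i`-th congruence identify two terms when they agree under all assignments that are constant on the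
classes of `∼ᵢ`. The generators witness `G`, so the inclusion yields a family of terms `t w`, one for
each vertex `w` of `H`, such that the distinguished ones are the corresponding variables, and
`t w = t w'` holds in `𝒱` after identification of the variables along `∼ᵢ` whenever `w` and `w'` are
connected by an edge labeled `i` (`exists_terms_of_congruences`).

Now let `c` witness `G` for weakly representable tolerances in an algebra `A`; the claim is that
`w ↦ t w (c)` witnesses `H`. If `R` is one of the relations representing the `i`-th tolerance, then
regularity gives an assignment `e`, constant on the classes of `∼ᵢ`, with `R (c v) (e v)` for all `v`
(`Regular.exists_constant_on_classes`): a class is a single point, or a single edge, which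
`R ∘ R⁻` connects through some `e`. Hence `R (t w (c)) (t w (e))`, `t w (e) = t w' (e)` and
`R (t w' (c)) (t w' (e))`.
-/

namespace GraphInclusion

open FirstOrder Language Structure CategoryTheory

/-! ### Compatible relations and terms -/

section Relations

variable {L : FirstOrder.Language.{u, v}} {A : Type w} [L.Structure A]

theorem Compatible.realize {R : A → A → Prop} (hR : Compatible L R) {ι : Type*}
    {x y : ι → A} (hxy : ∀ j, R (x j) (y j)) (t : L.Term ι) :
    R (t.realize x) (t.realize y) := by
  induction t with
  | var j => exact hxy j
  | func f ts ih => exact hR f _ _ ih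

theorem IsCongruence.isTolerance {α : A → A → Prop} (hα : IsCongruence L α) : IsTolerance L α :=
  ⟨hα.1.refl, fun _ _ => hα.1.symm, hα.2⟩

theorem IsCongruence.comp_self {α : A → A → Prop} (hα : IsCongruence L α) :
    Relation.Comp α α = α := by
  ext a b
  exact ⟨fun ⟨_, h₁, h₂⟩ => hα.1.trans h₁ h₂, fun h => ⟨a, hα.1.refl a, h⟩⟩

theorem IsTolerance.flip_eq {Θ : A → A → Prop} (hΘ : IsTolerance L Θ) : flip Θ = Θ := by
  ext a b
  exact ⟨hΘ.2.1 b a, hΘ.2.1 a b⟩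

theorem IsTolerance.isRepresentable_comp_self {Θ : A → A → Prop} (hΘ : IsTolerance L Θ) :
    IsRepresentable L (Relation.Comp Θ Θ) := by
  refine ⟨⟨fun a => ⟨a, hΘ.1 a, hΘ.1 a⟩, ?_, ?_⟩, Θ, hΘ.2.2, hΘ.1, by rw [hΘ.flip_eq]⟩
  · rintro a b ⟨e, h₁, h₂⟩
    exact ⟨e, hΘ.2.1 _ _ h₂, hΘ.2.1 _ _ h₁⟩
  · intro m f x y hxy
    choose e h₁ h₂ using hxy
    exact ⟨funMap f e, hΘ.2.2 f _ _ h₁, hΘ.2.2 f _ _ h₂⟩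

theorem IsRepresentable.isWeaklyRepresentable {Θ : A → A → Prop} (hΘ : IsRepresentable L Θ) :
    IsWeaklyRepresentable L Θ := by
  obtain ⟨hT, R, hR, hrefl, rfl⟩ := hΘ
  exact ⟨hT, PUnit, fun _ => R, fun _ => ⟨hR, hrefl⟩, fun a b => ⟨fun h _ => h, fun h => h ⟨⟩⟩⟩

end Relations

/-! ### The free algebra on countably many generators -/

section FreeAlgebra

variable {L : FirstOrder.Language.{u, v}} (𝒱 : Set (Bundled.{max u w} L.Structure))

/-- Two terms are identified if they are equal under every assignment into an algebra of `𝒱`. -/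
def identitySetoid : Setoid (L.Term ℕ) where
  r s t := ∀ A ∈ 𝒱, ∀ x : ℕ → A, s.realize x = t.realize x
  iseqv := ⟨fun _ _ _ _ => rfl, fun h A hA x => (h A hA x).symm,
    fun h h' A hA x => (h A hA x).trans (h' A hA x)⟩

/-- The free algebra of the class `𝒱` on the generators `0, 1, 2, …`: terms modulo the identities
of `𝒱`, lifted to the universe of the algebras in `𝒱`. -/
def FreeAlgebra : Type (max u w) :=
  ULift.{w} (Quotient (identitySetoid 𝒱))

namespace FreeAlgebra

variable {𝒱}

/-- The element of the free algebra that is represented by a term. -/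
def mk (t : L.Term ℕ) : FreeAlgebra 𝒱 :=
  ⟨Quotient.mk _ t⟩

/-- A term that represents the given element of the free algebra. -/
noncomputable def rep (a : FreeAlgebra 𝒱) : L.Term ℕ :=
  a.down.out

theorem mk_rep (a : FreeAlgebra 𝒱) : mk a.rep = a :=
  congrArg ULift.up (Quotient.out_eq a.down)

theorem mk_eq_mk {s t : L.Term ℕ} : (mk s : FreeAlgebra 𝒱) = mk t ↔
    ∀ A ∈ 𝒱, ∀ x : ℕ → A, s.realize x = t.realize x :=
  ULift.up_injective.eq_iff.trans Quotient.eq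

theorem realize_rep_mk (t : L.Term ℕ) {A : Bundled.{max u w} L.Structure} (hA : A ∈ 𝒱)
    (x : ℕ → A) : (mk t : FreeAlgebra 𝒱).rep.realize x = t.realize x :=
  mk_eq_mk.1 (mk_rep (mk t : FreeAlgebra 𝒱)) A hA x

noncomputable instance : L.Structure (FreeAlgebra 𝒱) where
  funMap f a := mk (.func f fun j => (a j).rep)
  -- The value is irrelevant: the language of an algebra has no relation symbols.
  RelMap _ _ := False

theorem realize_rep_funMap {m : ℕ} (f : L.Functions m) (a : Fin m → FreeAlgebra 𝒱)
    {A : Bundled.{max u w} L.Structure} (hA : A ∈ 𝒱) (x : ℕ → A) :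
    (funMap f a).rep.realize x = funMap f fun j => (a j).rep.realize x :=
  realize_rep_mk _ hA x

theorem realize_eq_mk_subst (t : L.Term ℕ) (a : ℕ → FreeAlgebra 𝒱) :
    t.realize a = mk (t.subst fun j => (a j).rep) := by
  induction t with
  | var j => exact (mk_rep _).symm
  | func f ts ih =>
    refine mk_eq_mk.2 fun A hA x => ?_
    simp only [ih, Term.realize_func, Term.subst, realize_rep_mk _ hA]

theorem mem_of_isVariety (h𝒱 : IsVariety 𝒱) :
    (⟨FreeAlgebra 𝒱, inferInstance⟩ : Bundled.{max u w} L.Structure) ∈ 𝒱 := by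
  obtain ⟨E, hE⟩ := h𝒱
  refine (hE _).2 ⟨⟨(mk (.var 0) : FreeAlgebra 𝒱)⟩, fun e he a => ?_⟩
  refine (realize_eq_mk_subst e.1 a).trans <| .trans ?_ (realize_eq_mk_subst e.2 a).symm
  refine mk_eq_mk.2 fun A hA x => ?_
  rw [Term.realize_subst, Term.realize_subst]
  exact ((hE A).1 hA).2 e he _

/-- The congruence of the free algebra that relates terms having equal values under all assignments
that satisfy `P`. -/
def agree (P : ∀ A : Bundled.{max u w} L.Structure, (ℕ → A) → Prop) (a b : FreeAlgebra 𝒱) : Prop :=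
  ∀ A ∈ 𝒱, ∀ x : ℕ → A, P A x → a.rep.realize x = b.rep.realize x

theorem isCongruence_agree (P : ∀ A : Bundled.{max u w} L.Structure, (ℕ → A) → Prop) :
    IsCongruence L (agree (𝒱 := 𝒱) P) := by
  refine ⟨⟨fun _ _ _ _ _ => rfl, fun h A hA x hx => (h A hA x hx).symm,
    fun h h' A hA x hx => (h A hA x hx).trans (h' A hA x hx)⟩, ?_⟩
  intro m f a b hab A hA x hx
  rw [realize_rep_funMap f a hA, realize_rep_funMap f b hA]
  exact congrArg _ (funext fun j => hab j A hA x hx)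

end FreeAlgebra

end FreeAlgebra

/-! ### The Mal'cev condition -/

section Malcev

variable {L : FirstOrder.Language.{u, v}} {𝒱 : Set (Bundled.{max u w} L.Structure)}
  {n h : ℕ} {V : Type uV} {W : Type uW} {G : LabeledGraph V n h} {H : LabeledGraph W n h}

/-- The Mal'cev condition expressed by the inclusion for congruences: terms `t w` in the vertices of
`G` (numbered by `ι`), among which the distinguished ones are variables, such that adjacent ones
become equal in `𝒱` when variables are identified along the corresponding `G.Conn i`. -/
theorem exists_terms_of_congruences (h𝒱 : IsVariety 𝒱) (ι : V → ℕ)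
    (hcong : ∀ A ∈ 𝒱, ∀ α : Fin n → A → A → Prop,
      (∀ i, IsCongruence L (α i)) → G.rel α ⊆ H.rel α) :
    ∃ t : W → L.Term ℕ,
      (∀ k, ∀ A ∈ 𝒱, ∀ x : ℕ → A, (t (H.dist k)).realize x = x (ι (G.dist k))) ∧
      ∀ i w w', H.Adj i w w' → ∀ A ∈ 𝒱, ∀ x : ℕ → A,
        (∀ v v', G.Conn i v v' → x (ι v) = x (ι v')) → (t w).realize x = (t w').realize x := by
  obtain ⟨c, hdist, hadj⟩ := hcong _ (FreeAlgebra.mem_of_isVariety h𝒱)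
    (fun i => FreeAlgebra.agree fun _ x => ∀ v v', G.Conn i v v' → x (ι v) = x (ι v'))
    (fun i => FreeAlgebra.isCongruence_agree _)
    ⟨fun v => FreeAlgebra.mk (.var (ι v)), fun _ => rfl, fun i v v' hvv' A hA x hx => by
      rw [FreeAlgebra.realize_rep_mk _ hA, FreeAlgebra.realize_rep_mk _ hA]
      exact hx v v' (.rel _ _ hvv')⟩
  refine ⟨fun w => FreeAlgebra.rep (c w), fun k A hA x => ?_, hadj⟩
  exact (congrArg (fun a => Term.realize x (FreeAlgebra.rep a)) (hdist k).symm).trans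
    (FreeAlgebra.realize_rep_mk _ hA x)

end Malcev

/-! ### Regular graphs -/

namespace LabeledGraph

variable {n h : ℕ} {V : Type uV} {G : LabeledGraph V n h}

/-- A class of `G.Conn i` does not contain three distinct vertices. -/
theorem Regular.eq_or_eq_or_eq_of_conn (hG : G.Regular) {i : Fin n} {x y z : V}
    (hxy : G.Conn i x y) (hxz : G.Conn i x z) : x = y ∨ x = z ∨ y = z := by
  by_contra! hne
  have hsub : ({x, y, z} : Set V) ⊆ {v | G.Conn i x v} := by
    rintro v (rfl | rfl | rfl)
    exacts [.refl _, hxy, hxz]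
  have hcard := (Set.encard_le_encard hsub).trans (hG.2 i x)
  rw [Set.encard_eq_three.2 ⟨x, y, z, hne.1, hne.2.1, hne.2.2, rfl⟩] at hcard
  exact absurd hcard (by norm_num)

theorem Regular.eq_or_adj_of_conn (hG : G.Regular) {i : Fin n} {x y : V} (hxy : G.Conn i x y) :
    x = y ∨ G.Adj i x y := by
  induction hxy with
  | rel x y h => exact .inr h
  | refl x => exact .inl rfl
  | symm x y _ ih => exact ih.imp Eq.symm (G.symm i x y)
  | trans x y z hxy hyz ih₁ ih₂ =>
    rcases hG.eq_or_eq_or_eq_of_conn hxy (.trans _ _ _ hxy hyz) with rfl | rfl | rfl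
    exacts [ih₂, .inl rfl, ih₁]

/-- If adjacent vertices are sent to pairs in `R ∘ R⁻`, then the whole assignment is `R`-related to
one that is constant on the classes of `G.Conn i`, because every class is a point or an edge. -/
theorem Regular.exists_constant_on_classes (hG : G.Regular) (i : Fin n) {A : Type w}
    {R : A → A → Prop} (hR : ∀ a, R a a) (c : V → A)
    (hc : ∀ x y, G.Adj i x y → Relation.Comp R (flip R) (c x) (c y)) :
    ∃ e : V → A, (∀ v, R (c v) (e v)) ∧ ∀ v v', G.Conn i v v' → e v = e v' := by
  have hclass : ∀ q : Quot (G.Conn i), ∃ a, ∀ v, Quot.mk _ v = q → R (c v) a := by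
    have heqv : Equivalence (G.Conn i) := Relation.EqvGen.is_equivalence _
    refine Quot.ind fun x => ?_
    have hmem : ∀ v, Quot.mk (G.Conn i) v = Quot.mk _ x → G.Conn i x v := fun v hv =>
      heqv.symm (heqv.eqvGen_iff.1 (Quot.eqvGen_exact hv))
    by_cases hx : ∃ y, x ≠ y ∧ G.Conn i x y
    · obtain ⟨y, hne, hxy⟩ := hx
      obtain ⟨a, hxa, hya⟩ := hc x y ((hG.eq_or_adj_of_conn hxy).resolve_left hne)
      refine ⟨a, fun v hv => ?_⟩
      rcases hG.eq_or_eq_or_eq_of_conn hxy (hmem v hv) with h | rfl | rfl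
      exacts [absurd h hne, hxa, hya]
    · refine ⟨c x, fun v hv => ?_⟩
      obtain rfl : x = v := by
        by_contra hne
        exact hx ⟨v, hne, hmem v hv⟩
      exact hR _
  choose e he using hclass
  exact ⟨fun v => e (Quot.mk _ v), fun v => he _ v rfl, fun v v' hvv' => congrArg e (Quot.sound hvv')⟩

end LabeledGraph

/-! ### From congruences to weakly representable tolerances -/

section Inclusion

variable {L : FirstOrder.Language.{u, v}} {𝒱 : Set (Bundled.{max u w} L.Structure)}
  {n h : ℕ} {V : Type uV} {W : Type uW} {G : LabeledGraph V n h} {H : LabeledGraph W n h}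

theorem rel_subset_rel_of_congruences (h𝒱 : IsVariety 𝒱) (hG : G.Regular)
    (hcong : ∀ A ∈ 𝒱, ∀ α : Fin n → A → A → Prop,
      (∀ i, IsCongruence L (α i)) → G.rel α ⊆ H.rel α)
    {A : Bundled.{max u w} L.Structure} (hA : A ∈ 𝒱) {Θ : Fin n → A → A → Prop}
    (hΘ : ∀ i, IsWeaklyRepresentable L (Θ i)) : G.rel Θ ⊆ H.rel Θ := by
  have := hG.1
  obtain ⟨ι, hι⟩ := exists_injective_nat V
  obtain ⟨t, htdist, htadj⟩ := exists_terms_of_congruences h𝒱 ι hcong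
  obtain ⟨a₀⟩ : Nonempty A := by
    obtain ⟨E, hE⟩ := h𝒱
    exact ((hE A).1 hA).1
  -- Variables that are not vertices of `G` may be assigned any value.
  let ext (e : V → A) : ℕ → A := Function.extend ι e fun _ => a₀
  have hext (e : V → A) (v : V) : ext e (ι v) = e v := hι.extend_apply _ _ _
  rintro a ⟨c, hdist, hadj⟩
  refine ⟨fun w => (t w).realize (ext c), fun k => ?_, fun i w w' hww' => ?_⟩
  · rw [hdist]
    exact (hext c _).symm.trans (htdist k A hA _).symm
  obtain ⟨-, K, R, hR, hΘR⟩ := hΘ i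
  refine (hΘR _ _).2 fun k => ?_
  obtain ⟨e, hce, he⟩ := hG.exists_constant_on_classes i (hR k).2 c
    fun x y hxy => (hΘR _ _).1 (hadj i x y hxy) k
  have hRext : ∀ j, R k (ext c j) (ext e j) := by
    intro j
    by_cases hj : ∃ v, ι v = j
    · obtain ⟨v, rfl⟩ := hj
      rw [hext, hext]
      exact hce v
    · simp only [ext, Function.extend_apply' _ _ _ hj]
      exact (hR k).2 a₀
  refine ⟨(t w).realize (ext e), (hR k).1.realize hRext _, ?_⟩
  rw [htadj i w w' hww' A hA (ext e) fun v v' hvv' => by rw [hext, hext, he v v' hvv'] ]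
  exact (hR k).1.realize hRext _

end Inclusion

end GraphInclusion

theorem theorem2 {L : FirstOrder.Language.{u, v}} [L.IsAlgebraic]
    (𝒱 : Set (CategoryTheory.Bundled.{max u w} L.Structure))
    (h𝒱 : GraphInclusion.IsVariety 𝒱)
    {n h : ℕ} {V : Type uV} {W : Type uW}
    (G : GraphInclusion.LabeledGraph V n h) (H : GraphInclusion.LabeledGraph W n h)
    (hG : G.Regular) :
    List.TFAE [
      ∀ A ∈ 𝒱, ∀ α : Fin n → A → A → Prop,
        (∀ i, GraphInclusion.IsCongruence L (α i)) → G.rel α ⊆ H.rel α,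
      ∀ A ∈ 𝒱, ∀ Θ : Fin n → A → A → Prop,
        (∀ i, GraphInclusion.IsRepresentable L (Θ i)) → G.rel Θ ⊆ H.rel Θ,
      ∀ A ∈ 𝒱, ∀ Θ : Fin n → A → A → Prop,
        (∀ i, GraphInclusion.IsWeaklyRepresentable L (Θ i)) → G.rel Θ ⊆ H.rel Θ,
      ∀ A ∈ 𝒱, ∀ Θ : Fin n → A → A → Prop,
        (∀ i, GraphInclusion.IsTolerance L (Θ i)) →
          G.rel (fun i => Relation.Comp (Θ i) (Θ i)) ⊆
            H.rel (fun i => Relation.Comp (Θ i) (Θ i))] := by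
  tfae_have 1 → 3 := fun hcong _ hA _ hΘ =>
    GraphInclusion.rel_subset_rel_of_congruences h𝒱 hG hcong hA hΘ
  tfae_have 3 → 2 := fun hweak A hA Θ hΘ =>
    hweak A hA Θ fun i => (hΘ i).isWeaklyRepresentable
  tfae_have 2 → 4 := fun hrep A hA Θ hΘ =>
    hrep A hA _ fun i => (hΘ i).isRepresentable_comp_self
  tfae_have 4 → 1 := by
    intro htol A hA α hα
    simpa only [(hα _).comp_self] using htol A hA α fun i => (hα i).isTolerance
  tfae_finish
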